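/- Let $0<\alpha\le\lambda<1$ be fixed. For every $m\in\mathbb N=\{1,2,\dots\}$ let $p_{1,m},\dots,p_{m,m}$ be $[0,1]$-valued random variables ($p$-values) on a probability space $(\Omega_m,\mathcal A_m,P_m)$, and let $\{1,\dots,m\}=I_{0,m}\sqcup I_{1,m}$ be a nonrandom partition with $m_0:=\#I_{0,m}\ge 1$. Assume basic independence: the vectors $(p_{i,m})_{i\in I_{0,m}}$ and $(p_{i,m})_{i\in I_{1,m}}$ are independent, and the $p_{i,m}$, $i\in I_{0,m}$, are independent and uniformly distributed on $[0,1]$; the dependence among the $p_{i,m}$, $i\in I_{1,m}$, is arbitrary. Let $\widehat F_m$ be the empirical distribution function of $p_{1,m},\dots,p_{m,m}$, and let $R_m(t):=m\widehat F_m(t)$. Let $\widehat m_0>0$ be an estimator which is a measurable function of $(\widehat F_m(t))_{t\ge\lambda}$ (the function may depend on $m$). Put $$\widehat\alpha_{i:m}:=\min\Bigl\{\frac{i}{\widehat m_0}\,\alpha,\ \lambda\Bigr\},\qquad i=0,\dots,m,$$ let $p_{1:m}\le\dots\le p_{m:m}$ be the ordered $p$-values, $p_{0:m}:=0$, and let $$R_m:=\max\{i\in\{0,\dots,m\}:\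 p_{i:m}\le\widehat\alpha_{i:m}\}$$ be the number of rejections of the adaptive step-up test. Suppose that $m_0/m\to 1$ as $m\to\infty$, and that there is a constant $C>1$ with $$\lim_{m\to\infty}P_m\Bigl(\widehat m_0\ \ge\ \frac{C\alpha}{\lambda}\,\max\{R_m(\lambda),1\}\Bigr)=1 .$$ Then $\widehat\alpha_{R_m:m}\to 0$ in $P_m$-probability, that is, $P_m(\widehat\alpha_{R_m:m}\ge\varepsilon)\to 0$ for every $\varepsilon>0$. If, in addition, there is some $K>0$ such that $\widehat m_0\le Km$ almost surely for all $m\in\mathbb N$, then also $R_m/m\to 0$ in $P_m$-probability. -/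

import Mathlib

open Filter Topology MeasureTheory ProbabilityTheory

noncomputable section

namespace AdaptiveStepUp

/-- Convergence in `P m`-probability of `X m` to the constant `c`, where the `X m` may live on
different probability spaces. -/
def TendstoInProb {Ω : ℕ → Type*} [∀ m, MeasurableSpace (Ω m)] (P : ∀ m, Measure (Ω m))
    (X : ∀ m, Ω m → ℝ) (c : ℝ) : Prop :=
  ∀ ε : ℝ, 0 < ε → Tendsto (fun m => P m {ω | ε ≤ |X m ω - c|}) atTop (𝓝 0)

/-- The basic independence model for `m` p-values. `I₀` is the set of true null hypotheses, its
complement is the set of false ones (whose p-values may depend on each other arbitrarily). -/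
structure BasicIndependence {Ω : Type*} [MeasurableSpace Ω] (P : Measure Ω) {m : ℕ}
    (I₀ : Finset (Fin m)) (p : Fin m → Ω → ℝ) : Prop where
  measurable : ∀ i, Measurable (p i)
  mem_Icc : ∀ i ω, p i ω ∈ Set.Icc (0 : ℝ) 1
  indep_true_false : IndepFun (fun ω (i : {i // i ∈ I₀}) => p i ω)
    (fun ω (i : {i // i ∉ I₀}) => p i ω) P
  indep_true : iIndepFun (fun (i : {i // i ∈ I₀}) ω => p i ω) P
  uniform_true : ∀ i ∈ I₀, ∀ x ∈ Set.Icc (0 : ℝ) 1, P {ω | p i ω ≤ x} = ENNReal.ofReal x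

/-- Empirical distribution function of the p-values `x 0, …, x (m - 1)`. -/
def ecdf {m : ℕ} (x : Fin m → ℝ) (t : ℝ) : ℝ :=
  ((Finset.univ.filter (fun i => x i ≤ t)).card : ℝ) / m

/-- `R_m(t) = m F̂_m(t)`, the number of p-values that are at most `t`. -/
def countLE {m : ℕ} (x : Fin m → ℝ) (t : ℝ) : ℝ :=
  m * ecdf x t

/-- The order statistics `x_{1:m} ≤ … ≤ x_{m:m}`, with `x_{0:m} = 0` (and the unused value `0`
for `i > m`). -/
def orderStat {m : ℕ} (x : Fin m → ℝ) (i : ℕ) : ℝ :=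
  if h : 1 ≤ i ∧ i ≤ m then x (Tuple.sort x ⟨i - 1, by omega⟩) else 0

/-- The data driven critical values `α̂_{i:m} = min {(i / m̂₀) α, λ}`; in particular
`α̂_{0:m} = 0`. The argument `μ` is the value of the estimator `m̂₀`. -/
def critVal (α lam μ : ℝ) (i : ℕ) : ℝ :=
  min ((i / μ) * α) lam

open Classical in
/-- Number of rejections `R_m = max {i = 0, …, m : x_{i:m} ≤ α̂_{i:m}}` of the adaptive step-up
test. -/
def numRejections {m : ℕ} (α lam μ : ℝ) (x : Fin m → ℝ) : ℕ :=
  Nat.findGreatest (fun i => orderStat x i ≤ critVal α lam μ i) m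

/-- `m̂₀` is a positive estimator that is a measurable function of `(F̂_m(t))_{t ≥ λ}` only. -/
def IsEstimator {Ω : Type*} {m : ℕ} (lam : ℝ) (p : Fin m → Ω → ℝ) (m0hat : Ω → ℝ) : Prop :=
  (∀ ω, 0 < m0hat ω) ∧
    ∃ g : (Set.Ici lam → ℝ) → ℝ, Measurable g ∧
      ∀ ω, m0hat ω = g (fun t => ecdf (fun i => p i ω) t)

end AdaptiveStepUp

end

namespace AdaptiveStepUp

/-! Let `t` be the critical value selected by the test and `R` the number of rejections. Two
estimates of `R` conflict unless `t` is small. Since at least `R` p-values lie in `[0, t]` and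
sparsity makes the empirical distribution nearly uniform, `R` is at most about `m t`. Conversely `t
≤ R α / m̂₀`, and with high probability `m̂₀` is at least about `C α m`, because `R_m(λ)` is close
to `m λ`; hence `R` is at least about `C m t`. As `C > 1`, `t` is bounded by the approximation
errors.

The probabilistic input is Chebyshev's inequality at finitely many fixed points
(`tendsto_meas_countLE_deviation`); the comparison of the two estimates is deterministic
(`critVal_numRejections_lt`). -/

lemma countLE_eq_card {m : ℕ} (x : Fin m → ℝ) (t : ℝ) :
    countLE x t = ((Finset.univ.filter (fun i => x i ≤ t)).card : ℝ) := by
  unfold countLE ecdf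
  rcases Nat.eq_zero_or_pos m with rfl | hm
  · simp
  · have : (m : ℝ) ≠ 0 := by positivity
    field_simp

lemma countLE_mono {m : ℕ} (x : Fin m → ℝ) {s t : ℝ} (h : s ≤ t) :
    countLE x s ≤ countLE x t := by
  rw [countLE_eq_card, countLE_eq_card, Nat.cast_le]
  refine Finset.card_le_card fun i hi => ?_
  simp only [Finset.mem_filter, Finset.mem_univ, true_and] at hi ⊢
  exact hi.trans h

lemma countLE_eq_sum {m : ℕ} (x : Fin m → ℝ) (t : ℝ) :
    countLE x t = ∑ i, (Set.Iic t).indicator (fun _ => (1 : ℝ)) (x i) := by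
  rw [countLE_eq_card]
  simp [Set.indicator_apply]

lemma measurable_countLE {Ω : Type*} [MeasurableSpace Ω] {m : ℕ} {p : Fin m → Ω → ℝ}
    (hp : ∀ i, Measurable (p i)) (t : ℝ) : Measurable (fun ω => countLE (fun i => p i ω) t) := by
  simp only [countLE_eq_sum]
  refine Finset.measurable_sum _ fun i _ => ?_
  exact (measurable_const.indicator measurableSet_Iic).comp (hp i)

lemma IsEstimator.measurable {Ω : Type*} [MeasurableSpace Ω] {m : ℕ} {lam : ℝ}
    {p : Fin m → Ω → ℝ} {m0hat : Ω → ℝ} (h : IsEstimator lam p m0hat)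
    (hp : ∀ i, Measurable (p i)) : Measurable m0hat := by
  obtain ⟨-, g, hg, hgm⟩ := h
  rw [show m0hat = fun ω => g (fun t => ecdf (fun i => p i ω) t) from funext hgm]
  refine hg.comp (measurable_pi_lambda _ fun t => ?_)
  rcases Nat.eq_zero_or_pos m with rfl | hm
  · simp [ecdf]
  · have hm' : (m : ℝ) ≠ 0 := by positivity
    have : (fun ω => ecdf (fun i => p i ω) (t : ℝ))
        = fun ω => countLE (fun i => p i ω) (t : ℝ) / m := by
      funext ω
      unfold countLE
      field_simp
    rw [this]
    exact (measurable_countLE hp t).div_const _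

/-- The step-up test rejects at most as many hypotheses as there are p-values below the critical
value it selects. -/
lemma numRejections_le_countLE {m : ℕ} (α lam μ : ℝ) (x : Fin m → ℝ) :
    (numRejections α lam μ x : ℝ)
      ≤ countLE x (critVal α lam μ (numRejections α lam μ x)) := by
  classical
  rw [countLE_eq_card, Nat.cast_le]
  set R := numRejections α lam μ x with hR
  rcases Nat.eq_zero_or_pos R with h0 | hpos
  · rw [h0]; exact Nat.zero_le _
  have hle : R ≤ m := Nat.findGreatest_le m
  have hP : orderStat x R ≤ critVal α lam μ R :=
    Nat.findGreatest_of_ne_zero (P := fun i => orderStat x i ≤ critVal α lam μ i)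
      hR.symm hpos.ne'
  rw [orderStat, dif_pos ⟨hpos, hle⟩] at hP
  -- Positions of the `R` smallest p-values; counting from zero, the largest of them has rank `R -
  -- 1`.
  let f : Fin R → Fin m := fun j => Tuple.sort x ⟨j, j.2.trans_le hle⟩
  have hf : Function.Injective f := by
    intro a b hab
    have := (Tuple.sort x).injective hab
    simpa [Fin.ext_iff] using this
  have hcard : (Finset.univ.image f).card = R := by
    rw [Finset.card_image_of_injective _ hf, Finset.card_univ, Fintype.card_fin]
  conv_lhs => rw [← hcard]
  refine Finset.card_le_card fun i hi => ?_
  obtain ⟨j, -, rfl⟩ := Finset.mem_image.1 hi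
  simp only [Finset.mem_filter, Finset.mem_univ, true_and]
  refine le_trans ?_ hP
  exact Tuple.monotone_sort x (Fin.mk_le_mk.2 (by have := j.2; omega))

lemma critVal_nonneg {α lam μ : ℝ} (hα : 0 ≤ α) (hlam : 0 ≤ lam) (hμ : 0 ≤ μ) (i : ℕ) :
    0 ≤ critVal α lam μ i :=
  le_min (by positivity) hlam

/-! ### Concentration of the empirical distribution function -/

/-- Chebyshev's inequality for the number of true null p-values in `[0, s]`. -/
lemma BasicIndependence.meas_true_count_le {Ω : Type*} [MeasurableSpace Ω] {P : Measure Ω}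
    [IsProbabilityMeasure P] {m : ℕ} {I₀ : Finset (Fin m)} {p : Fin m → Ω → ℝ}
    (h : BasicIndependence P I₀ p) {s : ℝ} (hs : s ∈ Set.Icc (0 : ℝ) 1) {c : ℝ} (hc : 0 < c) :
    P {ω | c ≤ |∑ i ∈ I₀, (Set.Iic s).indicator (fun _ => (1 : ℝ)) (p i ω) - I₀.card * s|}
      ≤ ENNReal.ofReal (I₀.card / c ^ 2) := by
  have hφ : Measurable ((Set.Iic s).indicator (fun _ => (1 : ℝ))) :=
    measurable_const.indicator measurableSet_Iic
  let Y : {i // i ∈ I₀} → Ω → ℝ := fun i ω => (Set.Iic s).indicator (fun _ => (1 : ℝ)) (p i ω)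
  have hYm : ∀ i, Measurable (Y i) := fun i => hφ.comp (h.measurable i)
  have hYb : ∀ i ω, ‖Y i ω‖ ≤ 1 := fun i ω => by
    simp only [Y, Set.indicator_apply]
    split_ifs <;> simp
  have hYL : ∀ i, MemLp (Y i) 2 P := fun i =>
    MemLp.of_bound (hYm i).aestronglyMeasurable 1 (ae_of_all _ (hYb i))
  have hYE : ∀ i, ∫ ω, Y i ω ∂P = s := fun i => by
    have : Y i = {ω | p i ω ≤ s}.indicator (fun _ => (1 : ℝ)) := by
      funext ω; simp [Y, Set.indicator_apply]
    rw [this, integral_indicator_const _ (measurableSet_le (h.measurable i) measurable_const),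
      Measure.real, h.uniform_true i i.2 s hs, ENNReal.toReal_ofReal hs.1]
    simp
  have hYV : ∀ i, variance (Y i) P ≤ 1 := fun i => by
    refine (variance_le_expectation_sq (hYm i).aestronglyMeasurable).trans ?_
    have := integral_mono (μ := P) (hYL i).integrable_sq (integrable_const (1 : ℝ))
      (fun ω => by
        have := hYb i ω
        rw [Real.norm_eq_abs] at this
        exact (sq_le_one_iff_abs_le_one _).2 this)
    simpa using this
  have hind : Set.Pairwise (↑(Finset.univ : Finset {i // i ∈ I₀}))
      fun i j => IndepFun (Y i) (Y j) P := fun i _ j _ hij =>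
    (h.indep_true.indepFun hij).comp hφ hφ
  have hV : variance (∑ i, Y i) P ≤ I₀.card := by
    rw [IndepFun.variance_sum (fun i _ => hYL i) hind]
    calc _ ≤ ∑ _i : {i // i ∈ I₀}, (1 : ℝ) := Finset.sum_le_sum fun i _ => hYV i
      _ = I₀.card := by simp
  have hE : ∫ ω, (∑ i, Y i) ω ∂P = I₀.card * s := by
    simp only [Finset.sum_apply]
    rw [integral_finsetSum _ fun i _ => (hYL i).integrable (by norm_num)]
    simp [hYE]
  have key := meas_ge_le_variance_div_sq (memLp_finsetSum' Finset.univ fun i _ => hYL i) hc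
  rw [hE] at key
  refine le_trans (le_of_eq ?_) (key.trans (ENNReal.ofReal_le_ofReal (by gcongr)))
  congr 1
  ext ω
  rw [Set.mem_ofPred_eq, Set.mem_ofPred_eq, Finset.sum_apply,
    ← Finset.sum_coe_sort I₀ fun i => (Set.Iic s).indicator (fun _ => (1 : ℝ)) (p i ω)]

/-- The false nulls number `m - m₀`, so both their count below `s` and its centring `(m - m₀) s` lie
in `[0, m - m₀]`, whatever their dependence. -/
lemma abs_countLE_sub_le {m : ℕ} (I₀ : Finset (Fin m)) (x : Fin m → ℝ) {s : ℝ}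
    (hs : s ∈ Set.Icc (0 : ℝ) 1) :
    |countLE x s - m * s|
      ≤ |∑ i ∈ I₀, (Set.Iic s).indicator (fun _ => (1 : ℝ)) (x i) - I₀.card * s|
        + (m - I₀.card) := by
  have hcard : ((I₀ᶜ).card : ℝ) = m - I₀.card := by
    rw [Finset.card_compl, Fintype.card_fin, Nat.cast_sub]
    simpa using Finset.card_le_univ I₀
  have hb : ∀ y, 0 ≤ (Set.Iic s).indicator (fun _ => (1 : ℝ)) y ∧
      (Set.Iic s).indicator (fun _ => (1 : ℝ)) y ≤ 1 := fun y => by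
    simp only [Set.indicator_apply]
    split_ifs <;> simp
  have h0 : 0 ≤ ∑ i ∈ I₀ᶜ, (Set.Iic s).indicator (fun _ => (1 : ℝ)) (x i) :=
    Finset.sum_nonneg fun i _ => (hb _).1
  have h1 : ∑ i ∈ I₀ᶜ, (Set.Iic s).indicator (fun _ => (1 : ℝ)) (x i) ≤ m - I₀.card := by
    rw [← hcard]
    refine (Finset.sum_le_sum fun i _ => (hb (x i)).2).trans ?_
    simp
  rw [countLE_eq_sum, ← Finset.sum_add_sum_compl I₀]
  set a := ∑ i ∈ I₀, (Set.Iic s).indicator (fun _ => (1 : ℝ)) (x i)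
  set b := ∑ i ∈ I₀ᶜ, (Set.Iic s).indicator (fun _ => (1 : ℝ)) (x i)
  have h2 : 0 ≤ ((m : ℝ) - I₀.card) * s := mul_nonneg (h0.trans h1) hs.1
  have h3 : ((m : ℝ) - I₀.card) * s ≤ m - I₀.card :=
    mul_le_of_le_one_right (h0.trans h1) hs.2
  have h4 : a + b - m * s = (a - I₀.card * s) + (b - (m - I₀.card) * s) := by ring
  rw [h4]
  exact (abs_add_le _ _).trans (by gcongr; rw [abs_le]; constructor <;> linarith)

section Asymptotics

variable {Ω : ℕ → Type*} [∀ m, MeasurableSpace (Ω m)] {P : ∀ m, Measure (Ω m)}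
  [∀ m, IsProbabilityMeasure (P m)] {I₀ : ∀ m, Finset (Fin m)} {p : ∀ m, Fin m → Ω m → ℝ}

/-- Under sparsity the empirical distribution function converges to the uniform one. -/
lemma tendsto_meas_countLE_deviation
    (hBI : ∀ m, 1 ≤ m → BasicIndependence (P m) (I₀ m) (p m))
    (hsparse : Tendsto (fun m : ℕ => ((I₀ m).card : ℝ) / m) atTop (𝓝 1))
    {s : ℝ} (hs : s ∈ Set.Icc (0 : ℝ) 1) {δ : ℝ} (hδ : 0 < δ) :
    Tendsto (fun m => P m {ω | δ * m ≤ |countLE (fun i => p m i ω) s - m * s|})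
      atTop (𝓝 0) := by
  have hlim : Tendsto (fun m : ℕ => ENNReal.ofReal (4 / δ ^ 2 / m)) atTop (𝓝 0) := by
    simpa using ENNReal.tendsto_ofReal (tendsto_const_div_atTop_nhds_zero_nat (4 / δ ^ 2))
  refine tendsto_of_tendsto_of_tendsto_of_le_of_le' tendsto_const_nhds hlim
    (Eventually.of_forall fun _ => zero_le) ?_
  filter_upwards [eventually_ge_atTop 1,
    -- Half of the tolerance `δ m` absorbs the false nulls; the other half is left for Chebyshev.
    hsparse.eventually (lt_mem_nhds (show 1 - δ / 2 < 1 by linarith))] with m hm hm0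
  have hmpos : (0 : ℝ) < m := by exact_mod_cast hm
  rw [lt_div_iff₀ hmpos] at hm0
  have hc : 0 < δ / 2 * m := by positivity
  refine (measure_mono ?_).trans (((hBI m hm).meas_true_count_le hs hc).trans
    (ENNReal.ofReal_le_ofReal ?_))
  · intro ω hω
    have h1 := abs_countLE_sub_le (I₀ m) (fun i => p m i ω) hs
    simp only [Set.mem_ofPred_eq] at hω ⊢
    linarith
  · have hcard : ((I₀ m).card : ℝ) ≤ m := by
      exact_mod_cast (Finset.card_le_univ (I₀ m)).trans_eq (Fintype.card_fin m)
    calc ((I₀ m).card : ℝ) / (δ / 2 * m) ^ 2 ≤ m / (δ / 2 * m) ^ 2 := by gcongr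
      _ = 4 / δ ^ 2 / m := by field_simp; norm_num

end Asymptotics

/-! ### Deterministic comparison of the two bounds on `R` -/

/-- If the empirical distribution function is close to the uniform one on the grid `k / N` and at
`lam`, and the estimator is large, then the critical value selected by the step-up test is
small. -/
lemma critVal_numRejections_lt {m : ℕ} (hm : 1 ≤ m) {α lam μ C ε δ : ℝ} {N : ℕ}
    (hα : 0 < α) (hlam0 : 0 < lam) (hlam : lam < 1) (hμ : 0 < μ) (hC : 1 < C) (hε : 0 < ε)
    (hN : 0 < N) (hsmall : 1 / (N : ℝ) + δ * (1 + C) ≤ (C - 1) * ε) (x : Fin m → ℝ)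
    (hest : C * α / lam * max (countLE x lam) 1 ≤ μ)
    (hgrid : ∀ k ∈ Finset.range (N + 1), |countLE x (k / N) - m * (k / N)| < δ * m)
    (hat : |countLE x lam - m * lam| < δ * m) :
    critVal α lam μ (numRejections α lam μ x) < ε := by
  by_contra! hcon
  have hRle := numRejections_le_countLE α lam μ x
  set R := numRejections α lam μ x
  set t := critVal α lam μ R with ht
  have htlam : t ≤ lam := min_le_right _ _
  have htR : t ≤ R / μ * α := min_le_left _ _
  have htpos : 0 < t := hε.trans_le hcon
  have hNpos : (0 : ℝ) < N := by exact_mod_cast hN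
  have hmpos : (0 : ℝ) < m := by exact_mod_cast hm
  have hδ : 0 < δ := pos_of_mul_pos_left ((abs_nonneg _).trans_lt hat) hmpos.le
  -- The point `t` depends on the data, so it is rounded up to the grid; monotonicity of the count
  -- makes this cost only `1 / N`.
  set k := ⌈t * N⌉₊
  have hkN : k ≤ N := Nat.ceil_le.2 (by nlinarith)
  have hk1 : t ≤ k / N := (le_div_iff₀ hNpos).2 (Nat.le_ceil _)
  have hk2 : (k : ℝ) / N < t + 1 / N := by
    rw [div_lt_iff₀ hNpos, add_mul, one_div, inv_mul_cancel₀ hNpos.ne']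
    exact Nat.ceil_lt_add_one (by positivity)
  have hupper : (R : ℝ) < (t + 1 / N + δ) * m := by
    have h1 := (abs_lt.1 (hgrid k (Finset.mem_range.2 (Nat.lt_succ_of_le hkN)))).2
    have h2 := countLE_mono x hk1
    have h3 := mul_lt_mul_of_pos_left hk2 hmpos
    linarith
  have hlower : t * C * ((lam - δ) * m) ≤ R * lam := by
    have h1 : (lam - δ) * m ≤ max (countLE x lam) 1 :=
      le_trans (by linarith [(abs_lt.1 hat).1]) (le_max_left _ _)
    have h2 : t * μ ≤ R * α := by
      rwa [div_mul_eq_mul_div, le_div_iff₀ hμ] at htR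
    have h3 : C * α * max (countLE x lam) 1 ≤ μ * lam := by
      rwa [div_mul_eq_mul_div, div_le_iff₀ hlam0] at hest
    have h4 : α * (t * C * ((lam - δ) * m)) ≤ α * (R * lam) := by
      calc α * (t * C * ((lam - δ) * m)) = t * (C * α * ((lam - δ) * m)) := by ring
        _ ≤ t * (C * α * max (countLE x lam) 1) := by gcongr
        _ ≤ t * (μ * lam) := by gcongr
        _ = t * μ * lam := by ring
        _ ≤ R * α * lam := by gcongr
        _ = α * (R * lam) := by ring
    exact le_of_mul_le_mul_left h4 hα
  have h5 : t * C * (lam - δ) < (t + 1 / N + δ) * lam := by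
    refine lt_of_mul_lt_mul_right ?_ hmpos.le
    calc t * C * (lam - δ) * m = t * C * ((lam - δ) * m) := by ring
      _ ≤ R * lam := hlower
      _ < (t + 1 / N + δ) * m * lam := by gcongr
      _ = _ := by ring
  -- Bounding `t` by `lam` in the error term lets `lam` cancel and produces the `δ * (1 + C)` of
  -- `hsmall`.
  have h6 : t * C * δ ≤ lam * C * δ := by gcongr
  have h7 : (C - 1) * ε ≤ (C - 1) * t := by gcongr
  have h8 : (C - 1) * t * lam < (1 / N + δ * (1 + C)) * lam := by linarith
  have h9 := lt_of_mul_lt_mul_right h8 hlam0.le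
  linarith

end AdaptiveStepUp

/-! ### The limit theorem -/

theorem lemma5p2 {Ω : ℕ → Type*} [∀ m, MeasurableSpace (Ω m)]
    (P : ∀ m, Measure (Ω m)) [∀ m, IsProbabilityMeasure (P m)]
    (α lam : ℝ) (hα : 0 < α) (hαlam : α ≤ lam) (hlam : lam < 1)
    -- for each number `m ≥ 1` of hypotheses: true nulls, p-values and the estimator of `m₀`
    (I₀ : ∀ m, Finset (Fin m)) (p : ∀ m, Fin m → Ω m → ℝ) (m0hat : ∀ m, Ω m → ℝ)
    (hBI : ∀ m, 1 ≤ m → AdaptiveStepUp.BasicIndependence (P m) (I₀ m) (p m))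
    (hm0 : ∀ m, 1 ≤ m → 1 ≤ (I₀ m).card)
    (hest : ∀ m, 1 ≤ m → AdaptiveStepUp.IsEstimator lam (p m) (m0hat m))
    -- sparsity: `m₀ / m → 1`
    (hA1 : Tendsto (fun m : ℕ => ((I₀ m).card : ℝ) / m) atTop (𝓝 1))
    -- `m̂₀ ≥ (C α / λ) (R_m(λ) ∨ 1)` with probability tending to one, for some `C > 1`
    (hA4 : ∃ C : ℝ, 1 < C ∧ Tendsto (fun m => P m {ω |
      C * α / lam * max (AdaptiveStepUp.countLE (fun i => p m i ω) lam) 1 ≤ m0hat m ω})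
        atTop (𝓝 1)) :
    AdaptiveStepUp.TendstoInProb P
      (fun m ω => AdaptiveStepUp.critVal α lam (m0hat m ω)
        (AdaptiveStepUp.numRejections α lam (m0hat m ω) (fun i => p m i ω))) 0 ∧
    ((∃ K : ℝ, 0 < K ∧ ∀ m : ℕ, 1 ≤ m → ∀ᵐ ω ∂(P m), m0hat m ω ≤ K * m) →
      AdaptiveStepUp.TendstoInProb P
        (fun m ω =>
          (AdaptiveStepUp.numRejections α lam (m0hat m ω) (fun i => p m i ω) : ℝ) / m) 0) := by
  have hlam0 : 0 < lam := hα.trans_le hαlam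
  have main : AdaptiveStepUp.TendstoInProb P
      (fun m ω => AdaptiveStepUp.critVal α lam (m0hat m ω)
        (AdaptiveStepUp.numRejections α lam (m0hat m ω) (fun i => p m i ω))) 0 := by
    obtain ⟨C, hC, hA⟩ := hA4
    intro ε hε
    have hCε : 0 < (C - 1) * ε := mul_pos (by linarith) hε
    -- The grid width and the deviation `δ` each use up half of `(C - 1) * ε`.
    obtain ⟨n, hn⟩ := exists_nat_one_div_lt (half_pos hCε)
    set N := n + 1 with hN
    set δ := (C - 1) * ε / 2 / (1 + C) with hδdef
    have hC1 : 0 < 1 + C := by linarith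
    have hδ : 0 < δ := by positivity
    have hsmall : 1 / (N : ℝ) + δ * (1 + C) ≤ (C - 1) * ε := by
      rw [hδdef, div_mul_cancel₀ _ hC1.ne', hN]
      push_cast
      linarith
    have hgridmem : ∀ k ∈ Finset.range (N + 1), ((k : ℝ) / N) ∈ Set.Icc (0 : ℝ) 1 := by
      intro k hk
      have hk' : (k : ℝ) ≤ N := by exact_mod_cast Nat.lt_succ_iff.1 (Finset.mem_range.1 hk)
      exact ⟨by positivity, div_le_one_of_le₀ hk' (by positivity)⟩
    have hbadest : Tendsto (fun m => P m {ω |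
        C * α / lam * max (AdaptiveStepUp.countLE (fun i => p m i ω) lam) 1 ≤ m0hat m ω}ᶜ)
          atTop (𝓝 0) := by
      have h1 : Tendsto (fun m => 1 - P m {ω |
          C * α / lam * max (AdaptiveStepUp.countLE (fun i => p m i ω) lam) 1 ≤ m0hat m ω})
            atTop (𝓝 0) := by
        simpa using ENNReal.Tendsto.sub tendsto_const_nhds hA (Or.inl ENNReal.one_ne_top)
      refine h1.congr' ?_
      filter_upwards [eventually_ge_atTop 1] with m hm
      rw [prob_compl_eq_one_sub]
      exact measurableSet_le
        (((AdaptiveStepUp.measurable_countLE (hBI m hm).measurable lam).max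
          measurable_const).const_mul _) ((hest m hm).measurable (hBI m hm).measurable)
    have hbadgrid := tendsto_finsetSum (Finset.range (N + 1)) fun k hk =>
      AdaptiveStepUp.tendsto_meas_countLE_deviation hBI hA1 (hgridmem k hk) hδ
    have hbadlam := AdaptiveStepUp.tendsto_meas_countLE_deviation hBI hA1
      (s := lam) ⟨hlam0.le, hlam.le⟩ hδ
    have hsum := (hbadest.add hbadgrid).add hbadlam
    simp only [Finset.sum_const_zero, add_zero] at hsum
    refine tendsto_of_tendsto_of_tendsto_of_le_of_le' tendsto_const_nhds hsum
      (Eventually.of_forall fun _ => zero_le) ?_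
    filter_upwards [eventually_ge_atTop 1] with m hm
    -- Union bound: the estimator is too small, or the count deviates at a grid point, or at `lam`,
    -- which need not be on the grid.
    refine le_trans (measure_mono ?_) ((measure_union_le _ _).trans
      (add_le_add_left ((measure_union_le _ _).trans
        (add_le_add_right (measure_biUnion_finset_le _ _) _)) _))
    intro ω hω
    by_contra hcon
    simp only [Set.mem_union, Set.mem_compl_iff, Set.mem_ofPred_eq, Set.mem_iUnion, not_or,
      not_exists, not_le] at hcon
    obtain ⟨⟨hE, hG⟩, hL⟩ := hcon
    have hpos := (hest m hm).1 ω
    have hlt := AdaptiveStepUp.critVal_numRejections_lt hm hα hlam0 hlam hpos hC hε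
      (Nat.succ_pos n) hsmall _ (not_lt.1 hE) hG hL
    rw [Set.mem_ofPred_eq, sub_zero,
      abs_of_nonneg (AdaptiveStepUp.critVal_nonneg hα.le hlam0.le hpos.le _)] at hω
    exact hω.not_gt hlt
  refine ⟨main, ?_⟩
  rintro ⟨K, hK, hKm⟩ η hη
  -- If `R / m ≥ η` and `m̂₀ ≤ K m`, then `R / m̂₀ ≥ η / K`, so the critical value is at least this
  -- threshold, truncated at `lam` as critical values are.
  refine tendsto_of_tendsto_of_tendsto_of_le_of_le' tendsto_const_nhds
    (main (min (η / K * α) lam) (lt_min (by positivity) hlam0))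
    (Eventually.of_forall fun _ => zero_le) ?_
  filter_upwards [eventually_ge_atTop 1] with m hm
  refine measure_mono_ae ?_
  filter_upwards [hKm m hm] with ω hω h
  have hmpos : (0 : ℝ) < m := by exact_mod_cast hm
  have hpos := (hest m hm).1 ω
  change η ≤ |(_ : ℝ) - 0| at h
  rw [sub_zero, abs_of_nonneg (by positivity), le_div_iff₀ hmpos] at h
  change _ ≤ |(_ : ℝ) - 0|
  rw [sub_zero, abs_of_nonneg (AdaptiveStepUp.critVal_nonneg hα.le hlam0.le hpos.le _)]
  refine min_le_min_right _ (mul_le_mul_of_nonneg_right ?_ hα.le)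
  rw [div_le_div_iff₀ hK hpos]
  calc η * m0hat m ω ≤ η * (K * m) := by gcongr
    _ = η * m * K := by ring
    _ ≤ _ := by gcongr
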